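/- For a real Banach space $X$ and $x\in X$ let $J_1(x)=\{p\in X^*:\ \|p\|=1,\ \langle p,x\rangle=\|x\|\}$, and for $\varepsilon\in[0,2]$ put $$\varphi^-_X(\varepsilon)=\inf\{\langle p,x-z\rangle:\ \|x\|=\|z\|=1,\ \|x-z\|\ge\varepsilon,\ p\in J_1(x)\},$$ $$\varphi^+_X(\varepsilon)=\sup\{\langle p,x-z\rangle:\ \|x\|=\|z\|=1,\ \|x-z\|\le\varepsilon,\ p\in J_1(x)\}.$$ Let $X$ be a real Banach space and $H$ a real Hilbert space, both of dimension at least $2$ (possibly infinite). Then for every $\varepsilon\in[0,2]$ $$\varphi^-_X(\varepsilon)\le\varphi^-_H(\varepsilon)=\frac{\varepsilon^2}{2}=\varphi^+_H(\varepsilon)\le\varphi^+_X(\varepsilon).$$ The same holds if, in both definitions, the constraint on $\|x-z\|$ is replaced by $\|x-z\|=\varepsilon$. -/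

import Mathlib

/-- `J₁(x)`: the norm-one continuous linear functionals `p` with `⟨p, x⟩ = ‖x‖`. -/
def normingFunctionals (X : Type*) [NormedAddCommGroup X] [NormedSpace ℝ X] (x : X) :
    Set (X →L[ℝ] ℝ) :=
  {p | ‖p‖ = 1 ∧ p x = ‖x‖}

/-- The numbers `⟨p, x - z⟩`, where `x`, `z` run over the unit sphere subject to `‖x - z‖ ∈ D`,
and `p` runs over `J₁(x)`. -/
def supportGaps (X : Type*) [NormedAddCommGroup X] [NormedSpace ℝ X] (D : Set ℝ) : Set ℝ :=
  {s | ∃ x z : X, ∃ p : X →L[ℝ] ℝ, ‖x‖ = 1 ∧ ‖z‖ = 1 ∧ ‖x - z‖ ∈ D ∧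
    p ∈ normingFunctionals X x ∧ s = p (x - z)}

/-- All these numbers lie in `[0, 2]`, so the suprema and infima below are taken over bounded
sets. -/
theorem supportGaps_subset_Icc (X : Type*) [NormedAddCommGroup X] [NormedSpace ℝ X]
    (D : Set ℝ) : supportGaps X D ⊆ Set.Icc 0 2 := by
  rintro s ⟨x, z, p, hx, hz, -, ⟨hp, hpx⟩, rfl⟩
  have h := p.le_opNorm z
  rw [hp, hz, Real.norm_eq_abs, one_mul] at h
  have h' := abs_le.mp h
  rw [map_sub, hpx, hx]
  constructor <;> linarith [h'.1, h'.2]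

/-- `φ⁻_X(ε) = inf {⟨p, x - z⟩ : ‖x‖ = ‖z‖ = 1, ‖x - z‖ ≥ ε, p ∈ J₁(x)}`. -/
noncomputable def phiMinus (X : Type*) [NormedAddCommGroup X] [NormedSpace ℝ X] (ε : ℝ) : ℝ :=
  sInf (supportGaps X (Set.Ici ε))

/-- `φ⁺_X(ε) = sup {⟨p, x - z⟩ : ‖x‖ = ‖z‖ = 1, ‖x - z‖ ≤ ε, p ∈ J₁(x)}`. -/
noncomputable def phiPlus (X : Type*) [NormedAddCommGroup X] [NormedSpace ℝ X] (ε : ℝ) : ℝ :=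
  sSup (supportGaps X (Set.Iic ε))

/-- The variant of `φ⁻_X(ε)` with the constraint `‖x - z‖ = ε`. -/
noncomputable def phiMinusEq (X : Type*) [NormedAddCommGroup X] [NormedSpace ℝ X] (ε : ℝ) : ℝ :=
  sInf (supportGaps X {ε})

/-- The variant of `φ⁺_X(ε)` with the constraint `‖x - z‖ = ε`. -/
noncomputable def phiPlusEq (X : Type*) [NormedAddCommGroup X] [NormedSpace ℝ X] (ε : ℝ) : ℝ :=
  sSup (supportGaps X {ε})

/-! In a plane of X, let x run round the unit circle, let z be the point ahead of it with ‖x - z‖ =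
ε, and put u = x - z. Where the circle is smooth, a functional p norming x has p(x) = 1 and p(dx) =
0, hence det(u, dx) = p(u) det(x, dx). Both z and -u/ε run round the same circle as x, so expanding
det(x - u, d(x - u)) and integrating by parts gives 2∮det(u, dx) = ε²∮det(x, dx). Thus ε²/2 is a
weighted mean of the gaps p(u) over chords of length exactly ε, and lies between their infimum and
supremum. In a Hilbert space every gap equals ‖x - z‖²/2, whence equality.

The circle may have corners and flat pieces, so nothing is differentiated. `planeDet_chord_ge` and
`planeDet_add_sub_eq` are finite-difference forms of the two identities, and
`le_of_forall_sub_ge_neg_sq` absorbs the quadratic errors. Indexing chords by their mid-angle makes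
both endpoints monotone and Lipschitz, thanks to `norm_map_circPt_sub_mono`. By central symmetry
half a turn suffices. A sign σ treats infimum and supremum together. -/

open Complex (I)

/-! ### Plane determinants and a quadrilateral inequality -/

/-- The determinant of two plane vectors. -/
def planeDet (u v : ℂ) : ℝ := u.re * v.im - u.im * v.re

theorem abs_planeDet_le (u v : ℂ) : |planeDet u v| ≤ 2 * (‖u‖ * ‖v‖) := by
  have h1 := mul_le_mul (Complex.abs_re_le_norm u) (Complex.abs_im_le_norm v)
    (abs_nonneg _) (norm_nonneg _)
  have h2 := mul_le_mul (Complex.abs_im_le_norm u) (Complex.abs_re_le_norm v)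
    (abs_nonneg _) (norm_nonneg _)
  have h3 := abs_sub (u.re * v.im) (u.im * v.re)
  rw [abs_mul, abs_mul] at h3
  unfold planeDet
  linarith

/-- A functional killing `d` is proportional to `planeDet · d`. -/
theorem planeDet_mul_apply (g : ℂ →ₗ[ℝ] ℝ) (v x d : ℂ) (hd : g d = 0) :
    planeDet v d * g x = g v * planeDet x d := by
  have key (u : ℂ) : g u = u.re * g 1 + u.im * g I := by
    have : u = u.re • (1 : ℂ) + u.im • I := by
      apply Complex.ext <;> simp
    conv_lhs => rw [this]
    rw [map_add, map_smul, map_smul, smul_eq_mul, smul_eq_mul]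
  rw [key] at hd
  rw [key x, key v]
  unfold planeDet
  linear_combination (x.im * v.re - x.re * v.im) * hd

/-- Sum of two opposite sides against the sum of the diagonals of a quadrilateral. -/
theorem norm_sub_le_of_mem_sector {X : Type*} [NormedAddCommGroup X] [NormedSpace ℝ X]
    {x y z : X} (hy : ‖y‖ = 1) (hz : ‖z‖ = 1) {a b : ℝ} (ha : 0 ≤ a) (hb : 0 ≤ b)
    (h : y = a • x + b • z) (hx : ‖x‖ = 1) : ‖x - y‖ ≤ ‖x - z‖ := by
  have hab : 1 ≤ a + b := by
    have := norm_add_le (a • x) (b • z)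
    rwa [← h, hy, norm_smul, norm_smul, hx, hz, mul_one, mul_one, Real.norm_of_nonneg ha,
      Real.norm_of_nonneg hb] at this
  have hpos : 0 < a + b := by linarith
  set t := b / (a + b) with ht
  have ht0 : 0 ≤ t := by positivity
  have ht1 : 0 ≤ 1 - t := by
    rw [ht, sub_nonneg, div_le_one hpos]; linarith
  -- The diagonals of the quadrilateral 0, x, y, z cross at `m`: the ray through `y` meets the
  -- segment from `x` to `z` there.
  set m : X := (a + b)⁻¹ • y with hm
  have hm' : m = (1 - t) • x + t • z := by
    rw [hm, h, smul_add, smul_smul, smul_smul, ht]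
    congr 2 <;> field_simp
    ring
  have h1 : ‖x - m‖ + ‖m - z‖ = ‖x - z‖ := by
    have e1 : x - m = t • (x - z) := by rw [hm']; module
    have e2 : m - z = (1 - t) • (x - z) := by rw [hm']; module
    rw [e1, e2, norm_smul, norm_smul, Real.norm_of_nonneg ht0, Real.norm_of_nonneg ht1]
    ring
  have hs : (a + b)⁻¹ ≤ 1 := inv_le_one_of_one_le₀ hab
  have hs0 : 0 ≤ (a + b)⁻¹ := by positivity
  have h2 : ‖m - y‖ + ‖m‖ = 1 := by
    have e1 : y - m = (1 - (a + b)⁻¹) • y := by rw [hm]; module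
    rw [norm_sub_rev, e1, hm, norm_smul, norm_smul, hy, Real.norm_of_nonneg hs0,
      Real.norm_of_nonneg (sub_nonneg.2 hs)]
    ring
  have h3 : ‖x - y‖ ≤ ‖x - m‖ + ‖m - y‖ := norm_sub_le_norm_sub_add_norm_sub ..
  have h4 : ‖z‖ ≤ ‖m‖ + ‖m - z‖ := by
    have := norm_sub_le m (m - z)
    simpa using this
  linarith

/-! ### Polar coordinates on the unit circle of a plane in X -/

/-- The unit vector of the plane with angle `t`. -/
noncomputable def unitDir (t : ℝ) : ℂ := Complex.exp (t * I)

theorem norm_unitDir (t : ℝ) : ‖unitDir t‖ = 1 := Complex.norm_exp_ofReal_mul_I t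

theorem unitDir_re (t : ℝ) : (unitDir t).re = Real.cos t := Complex.exp_ofReal_mul_I_re t

theorem unitDir_im (t : ℝ) : (unitDir t).im = Real.sin t := Complex.exp_ofReal_mul_I_im t

theorem unitDir_add_pi (t : ℝ) : unitDir (t + Real.pi) = -unitDir t := by
  apply Complex.ext <;> simp [unitDir_re, unitDir_im]

theorem continuous_unitDir : Continuous unitDir := by
  unfold unitDir; fun_prop

theorem norm_unitDir_sub_le (s t : ℝ) : ‖unitDir s - unitDir t‖ ≤ |s - t| := by
  have h : unitDir s - unitDir t = unitDir t * (Complex.exp (I * (s - t : ℝ)) - 1) := by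
    unfold unitDir
    rw [mul_sub, ← Complex.exp_add, mul_one]
    congr 2
    push_cast; ring
  rw [h, norm_mul, norm_unitDir, one_mul]
  exact Real.norm_exp_I_mul_ofReal_sub_one_le

section Circle

variable {X : Type*} [NormedAddCommGroup X] [NormedSpace ℝ X] (L : ℂ →L[ℝ] X)

/-- The Euclidean length of the vector with angle `t` and `‖L ·‖ = 1`. -/
noncomputable def circRadius (t : ℝ) : ℝ := ‖L (unitDir t)‖⁻¹

/-- The plane vector with angle `t` and `‖L ·‖ = 1`. -/
noncomputable def circPt (t : ℝ) : ℂ := circRadius L t • unitDir t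

theorem exists_bound_below {L : ℂ →L[ℝ] X} (hL : Function.Injective L) :
    ∃ m > 0, ∀ u, m * ‖u‖ ≤ ‖L u‖ := by
  obtain ⟨K, hK, h⟩ := L.toLinearMap.injective_iff_antilipschitz.1 hL
  refine ⟨(K : ℝ)⁻¹, by positivity, fun u => ?_⟩
  have := h.le_mul_norm (map_zero _) u
  rw [inv_mul_le_iff₀ (by positivity)]
  simpa using this

variable {L} (hL : Function.Injective L)
include hL

theorem norm_map_unitDir_pos (t : ℝ) : 0 < ‖L (unitDir t)‖ := by
  rw [norm_pos_iff, ne_eq, map_eq_zero_iff L hL]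
  exact Complex.exp_ne_zero _

theorem circRadius_pos (t : ℝ) : 0 < circRadius L t := inv_pos.2 (norm_map_unitDir_pos hL t)

theorem norm_map_circPt (t : ℝ) : ‖L (circPt L t)‖ = 1 := by
  rw [circPt, map_smul, norm_smul, Real.norm_of_nonneg (circRadius_pos hL t).le, circRadius,
    inv_mul_cancel₀ (norm_map_unitDir_pos hL t).ne']

theorem circPt_of_polar {ρ t : ℝ} {u : ℂ} (hρ : 0 ≤ ρ) (hu : u = ρ * unitDir t) :
    u = ‖L u‖ • circPt L t := by
  have h1 : u = ρ • unitDir t := by rw [hu, Complex.real_smul]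
  have h2 : ‖L u‖ = ρ * ‖L (unitDir t)‖ := by
    rw [h1, map_smul, norm_smul, Real.norm_of_nonneg hρ]
  rw [h2, circPt, circRadius, smul_smul, mul_assoc,
    mul_inv_cancel₀ (norm_map_unitDir_pos hL t).ne', mul_one, h1]

theorem continuous_circRadius : Continuous (circRadius L) :=
  ((L.continuous.comp continuous_unitDir).norm).inv₀ fun t => (norm_map_unitDir_pos hL t).ne'

theorem continuous_circPt : Continuous (circPt L) :=
  (continuous_circRadius hL).smul continuous_unitDir

/-- The norm pulled back by `L` is equivalent to the Euclidean one, so the radius is the reciprocal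
of a Lipschitz function bounded away from 0. A single constant keeps the later error estimates
short. -/
theorem exists_circ_constants : ∃ K, 1 ≤ K ∧ (∀ u, ‖L u‖ ≤ K * ‖u‖) ∧
    (∀ t, circRadius L t ≤ K) ∧ (∀ t, 1 ≤ K * circRadius L t) ∧
    (∀ s t, |circRadius L s - circRadius L t| ≤ K * |s - t|) ∧
    (∀ t, ‖circPt L t‖ ≤ K) ∧ ∀ s t, ‖circPt L s - circPt L t‖ ≤ K * |s - t| := by
  obtain ⟨m, hm, hmL⟩ := exists_bound_below hL
  have hr (t) : circRadius L t ≤ m⁻¹ := by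
    refine inv_anti₀ hm ?_
    simpa [norm_unitDir] using hmL (unitDir t)
  have hr' (s t) : |circRadius L s - circRadius L t| ≤ ‖L‖ * m⁻¹ * m⁻¹ * |s - t| := by
    have hs := norm_map_unitDir_pos hL s
    have ht := norm_map_unitDir_pos hL t
    have e : circRadius L s - circRadius L t =
        (‖L (unitDir t)‖ - ‖L (unitDir s)‖) * (circRadius L s * circRadius L t) := by
      unfold circRadius; field_simp
    rw [e, abs_mul, abs_of_pos (mul_pos (circRadius_pos hL s) (circRadius_pos hL t))]
    have h1 : |‖L (unitDir t)‖ - ‖L (unitDir s)‖| ≤ ‖L‖ * |s - t| := by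
      refine (abs_norm_sub_norm_le _ _).trans ?_
      rw [← map_sub]
      refine (L.le_opNorm _).trans ?_
      rw [abs_sub_comm]
      gcongr
      exact norm_unitDir_sub_le _ _
    have h2 : circRadius L s * circRadius L t ≤ m⁻¹ * m⁻¹ :=
      mul_le_mul (hr s) (hr t) (circRadius_pos hL t).le (by positivity)
    calc _ ≤ (‖L‖ * |s - t|) * (m⁻¹ * m⁻¹) := by
          gcongr
          exact (mul_pos (circRadius_pos hL s) (circRadius_pos hL t)).le
      _ = _ := by ring
  have hn (t) : ‖circPt L t‖ = circRadius L t := by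
    rw [circPt, norm_smul, norm_unitDir, mul_one, Real.norm_of_nonneg (circRadius_pos hL t).le]
  have hx (s t) : ‖circPt L s - circPt L t‖ ≤ (‖L‖ * m⁻¹ * m⁻¹ + m⁻¹) * |s - t| := by
    have e : circPt L s - circPt L t = (circRadius L s - circRadius L t) • unitDir s +
        circRadius L t • (unitDir s - unitDir t) := by
      unfold circPt; module
    rw [e]
    refine (norm_add_le _ _).trans ?_
    rw [norm_smul, norm_smul, norm_unitDir, mul_one, add_mul,
      Real.norm_of_nonneg (circRadius_pos hL t).le]
    exact add_le_add (hr' s t) (mul_le_mul (hr t) (norm_unitDir_sub_le s t) (norm_nonneg _)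
      (by positivity))
  have hmi : 0 < m⁻¹ := by positivity
  have hN := norm_nonneg L
  have hp : 0 ≤ ‖L‖ * m⁻¹ * m⁻¹ := by positivity
  refine ⟨1 + ‖L‖ + m⁻¹ + ‖L‖ * m⁻¹ * m⁻¹, by linarith, fun u => ?_, fun t => ?_, fun t => ?_,
    fun s t => ?_, fun t => ?_, fun s t => ?_⟩
  · exact (L.le_opNorm u).trans (mul_le_mul_of_nonneg_right (by linarith) (norm_nonneg _))
  · linarith [hr t]
  · have h1 : ‖L (unitDir t)‖ ≤ ‖L‖ := by simpa [norm_unitDir] using L.le_opNorm (unitDir t)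
    have h2 := norm_map_unitDir_pos hL t
    have h3 : 1 ≤ ‖L‖ * circRadius L t := by
      rw [circRadius, ← div_eq_mul_inv, le_div_iff₀ h2]; linarith
    refine h3.trans (mul_le_mul_of_nonneg_right (by linarith) (circRadius_pos hL t).le)
  · exact (hr' s t).trans (mul_le_mul_of_nonneg_right (by linarith) (abs_nonneg _))
  · rw [hn]; linarith [hr t]
  · exact (hx s t).trans (mul_le_mul_of_nonneg_right (by linarith) (abs_nonneg _))

omit hL in
theorem circRadius_add_pi (t : ℝ) : circRadius L (t + Real.pi) = circRadius L t := by
  rw [circRadius, circRadius, unitDir_add_pi, map_neg, norm_neg]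

omit hL in
theorem circPt_add_pi (t : ℝ) : circPt L (t + Real.pi) = -circPt L t := by
  rw [circPt, circRadius_add_pi, unitDir_add_pi, smul_neg, circPt]

omit hL in
theorem planeDet_circPt (s t : ℝ) : planeDet (circPt L s) (circPt L t) =
    circRadius L s * circRadius L t * Real.sin (t - s) := by
  simp only [planeDet, circPt, Complex.smul_re, Complex.smul_im, unitDir_re, unitDir_im,
    smul_eq_mul, Real.sin_sub]
  ring

/-! ### Area swept along the unit circle -/

/-- Twice the area swept by `circPt` on `[0, t]`. -/
noncomputable def circArea (L : ℂ →L[ℝ] X) (t : ℝ) : ℝ := ∫ s in (0 : ℝ)..t, circRadius L s ^ 2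

theorem circArea_sub (s t : ℝ) :
    circArea L t - circArea L s = ∫ v in s..t, circRadius L v ^ 2 := by
  have hi (a b) : IntervalIntegrable (fun v => circRadius L v ^ 2) MeasureTheory.volume a b :=
    ((continuous_circRadius hL).pow 2).intervalIntegrable a b
  exact intervalIntegral.integral_interval_sub_left (hi _ _) (hi _ _)

theorem circArea_add_pi (t : ℝ) : circArea L (t + Real.pi) - circArea L t = circArea L Real.pi := by
  have hp : Function.Periodic (fun v => circRadius L v ^ 2) Real.pi := fun v => by
    simp only [circRadius_add_pi]
  rw [circArea_sub hL, hp.intervalIntegral_add_eq t 0, zero_add, circArea]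

theorem circArea_pi_pos : 0 < circArea L Real.pi :=
  intervalIntegral.intervalIntegral_pos_of_pos
    (((continuous_circRadius hL).pow 2).intervalIntegrable _ _)
    (fun t => pow_pos (circRadius_pos hL t) 2) Real.pi_pos

/-- Sector and triangle both agree with r(s)²(t - s) up to a quadratic error, because the radius r
is Lipschitz. This replaces differentiating the area. -/
theorem exists_circArea_sub_planeDet_le : ∃ K, 0 ≤ K ∧ ∀ s t, |t - s| ≤ 1 →
    |circArea L t - circArea L s - planeDet (circPt L s) (circPt L t)| ≤ K * (t - s) ^ 2 := by
  obtain ⟨K, hK1, -, hK2, -, hK3, -, -⟩ := exists_circ_constants hL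
  refine ⟨4 * K ^ 2, by positivity, fun s t hst => ?_⟩
  have hs0 := circRadius_pos hL s
  have ht0 := circRadius_pos hL t
  have h1 : |circArea L t - circArea L s - circRadius L s ^ 2 * (t - s)| ≤
      2 * K ^ 2 * |t - s| * |t - s| := by
    have : circArea L t - circArea L s - circRadius L s ^ 2 * (t - s) =
        ∫ v in s..t, (circRadius L v ^ 2 - circRadius L s ^ 2) := by
      rw [intervalIntegral.integral_sub (f := fun v => circRadius L v ^ 2)
        (((continuous_circRadius hL).pow 2).intervalIntegrable _ _) intervalIntegrable_const,
        circArea_sub hL, intervalIntegral.integral_const, smul_eq_mul, mul_comm (t - s)]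
    rw [this, ← Real.norm_eq_abs]
    apply intervalIntegral.norm_integral_le_of_norm_le_const
    intro v hv
    have hv' : |v - s| ≤ |t - s| := by
      have := Set.abs_sub_left_of_mem_uIcc (Set.uIoc_subset_uIcc hv)
      rw [abs_sub_comm, abs_sub_comm t]; rw [abs_sub_comm, abs_sub_comm t] at this
      exact this
    have hv0 := circRadius_pos hL v
    rw [sq_sub_sq, norm_mul, Real.norm_of_nonneg (by positivity), Real.norm_eq_abs]
    calc _ ≤ (K + K) * (K * |v - s|) :=
          mul_le_mul (add_le_add (hK2 _) (hK2 _)) (hK3 _ _) (abs_nonneg _) (by linarith)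
      _ ≤ (K + K) * (K * |t - s|) := by gcongr
      _ = _ := by ring
  have h2 : |Real.sin (t - s) - (t - s)| ≤ |t - s| ^ 2 := by
    have h := Real.sin_bound hst
    have h0 := abs_nonneg (t - s)
    have e : Real.sin (t - s) - (t - s) =
        (Real.sin (t - s) - ((t - s) - (t - s) ^ 3 / 6)) + -((t - s) ^ 3 / 6) := by ring
    rw [e]
    refine (abs_add_le _ _).trans ?_
    rw [abs_neg, abs_div, abs_pow, abs_of_pos (show (0 : ℝ) < 6 by norm_num)]
    have h3 : |t - s| ^ 3 ≤ |t - s| ^ 2 := pow_le_pow_of_le_one h0 hst (by norm_num)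
    have h4 : |t - s| ^ 4 ≤ |t - s| ^ 2 := pow_le_pow_of_le_one h0 hst (by norm_num)
    nlinarith [sq_nonneg |t - s|]
  have h3 : |Real.sin (t - s)| ≤ |t - s| := by
    simpa using Real.abs_sin_sub_sin_le (t - s) 0
  rw [planeDet_circPt]
  -- Three errors: freezing the radius in the integral, replacing r(t) by r(s), and replacing the
  -- sine by its argument.
  have e : circArea L t - circArea L s -
      circRadius L s * circRadius L t * Real.sin (t - s) =
      (circArea L t - circArea L s - circRadius L s ^ 2 * (t - s)) +
      -(circRadius L s * (circRadius L t - circRadius L s) * Real.sin (t - s)) +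
      -(circRadius L s ^ 2 * (Real.sin (t - s) - (t - s))) := by ring
  rw [e]
  refine (abs_add_three _ _ _).trans ?_
  rw [abs_neg, abs_neg, abs_mul, abs_mul, abs_mul, abs_of_pos hs0, abs_pow, abs_of_pos hs0]
  have h4 : circRadius L s * |circRadius L t - circRadius L s| * |Real.sin (t - s)| ≤
      K * (K * |t - s|) * |t - s| := by
    gcongr
    · exact hK2 s
    · exact hK3 t s
  have h5 : circRadius L s ^ 2 * |Real.sin (t - s) - (t - s)| ≤ K ^ 2 * |t - s| ^ 2 := by
    gcongr
    exact hK2 s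
  rw [← sq_abs (t - s)]
  linarith

end Circle

/-! ### Chords of a given length -/

section Level

variable {X : Type*} [NormedAddCommGroup X] [NormedSpace ℝ X] {L : ℂ →L[ℝ] X}

/-- With e(·) the Euclidean unit vector, sin(t - s) e(v) = sin(t - v) e(s) + sin(v - s) e(t), and
all three sines are nonnegative on an arc shorter than π. -/
theorem exists_nonneg_combination_circPt (hL : Function.Injective L) {s t v : ℝ} (hsv : s ≤ v)
    (hvt : v ≤ t) (hst : s < t) (hts : t < s + Real.pi) :
    ∃ a b : ℝ, 0 ≤ a ∧ 0 ≤ b ∧ circPt L v = a • circPt L s + b • circPt L t := by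
  have hS : 0 < Real.sin (t - s) := Real.sin_pos_of_pos_of_lt_pi (by linarith) (by linarith)
  have h1 : 0 ≤ Real.sin (t - v) := Real.sin_nonneg_of_nonneg_of_le_pi (by linarith) (by linarith)
  have h2 : 0 ≤ Real.sin (v - s) := Real.sin_nonneg_of_nonneg_of_le_pi (by linarith) (by linarith)
  have hs := circRadius_pos hL s
  have ht := circRadius_pos hL t
  have hv := circRadius_pos hL v
  refine ⟨circRadius L v * Real.sin (t - v) / (circRadius L s * Real.sin (t - s)),
    circRadius L v * Real.sin (v - s) / (circRadius L t * Real.sin (t - s)),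
    by positivity, by positivity, ?_⟩
  have key : Real.sin (t - s) • unitDir v =
      Real.sin (t - v) • unitDir s + Real.sin (v - s) • unitDir t := by
    apply Complex.ext <;>
      simp only [Complex.add_re, Complex.add_im, Complex.smul_re, Complex.smul_im, smul_eq_mul,
        unitDir_re, unitDir_im, Real.sin_sub] <;> ring
  have key' : unitDir v = (Real.sin (t - s))⁻¹ •
      (Real.sin (t - v) • unitDir s + Real.sin (v - s) • unitDir t) := by
    rw [← key, smul_smul, inv_mul_cancel₀ hS.ne', one_smul]
  simp only [circPt]
  rw [key', smul_add, smul_add, smul_smul, smul_smul, smul_smul, smul_smul, smul_smul, smul_smul]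
  congr 2 <;> field_simp

theorem norm_map_circPt_sub_add_pi (hL : Function.Injective L) (s : ℝ) :
    ‖L (circPt L s - circPt L (s + Real.pi))‖ = 2 := by
  rw [circPt_add_pi, sub_neg_eq_add, ← two_smul ℝ, map_smul, norm_smul, norm_map_circPt hL]
  simp

theorem norm_map_circPt_sub_le_two (hL : Function.Injective L) (s t : ℝ) :
    ‖L (circPt L s - circPt L t)‖ ≤ 2 := by
  rw [map_sub]
  refine (norm_sub_le _ _).trans ?_
  rw [norm_map_circPt hL, norm_map_circPt hL]
  norm_num

/-- Chords of the unit circle grow with the arc inside a half circle. -/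
theorem norm_map_circPt_sub_mono (hL : Function.Injective L) {s s' t' t : ℝ} (hs : s ≤ s')
    (h' : s' ≤ t') (ht : t' ≤ t) (hst : t ≤ s + Real.pi) :
    ‖L (circPt L s' - circPt L t')‖ ≤ ‖L (circPt L s - circPt L t)‖ := by
  rcases hst.eq_or_lt with rfl | hlt
  · rw [norm_map_circPt_sub_add_pi hL]
    exact norm_map_circPt_sub_le_two hL _ _
  rcases (hs.trans (h'.trans ht)).eq_or_lt with h | h
  · have e1 : s' = t' := by linarith
    rw [e1, sub_self, map_zero, norm_zero]
    exact norm_nonneg _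
  -- The endpoints are moved one at a time, through the chord from `s` to `t'`.
  have h1 : ‖L (circPt L s) - L (circPt L t')‖ ≤ ‖L (circPt L s) - L (circPt L t)‖ := by
    obtain ⟨a, b, ha, hb, e⟩ := exists_nonneg_combination_circPt hL (hs.trans h') ht h hlt
    refine norm_sub_le_of_mem_sector (norm_map_circPt hL _) (norm_map_circPt hL _) ha hb ?_
      (norm_map_circPt hL _)
    rw [e, map_add, map_smul, map_smul]
  refine le_trans ?_ (by simpa only [map_sub] using h1)
  rcases (hs.trans h').eq_or_lt with h2 | h2
  · have e1 : s' = t' := by linarith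
    rw [e1, sub_self, map_zero, norm_zero]
    exact norm_nonneg _
  obtain ⟨a, b, ha, hb, e⟩ := exists_nonneg_combination_circPt hL hs h' h2 (by linarith)
  simp only [map_sub]
  rw [norm_sub_rev, norm_sub_rev (L (circPt L s))]
  refine norm_sub_le_of_mem_sector (norm_map_circPt hL _) (norm_map_circPt hL _) hb ha ?_
      (norm_map_circPt hL _)
  rw [e, map_add, map_smul, map_smul, add_comm]

/-- The length of the chord whose endpoints have angles `(s - w) / 2` and `(s + w) / 2`. -/
noncomputable def chordLength (L : ℂ →L[ℝ] X) (s w : ℝ) : ℝ :=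
  ‖L (circPt L ((s - w) / 2) - circPt L ((s + w) / 2))‖

/-- The largest width of an arc centred at `s / 2` whose chord has length at most `ε`. -/
noncomputable def chordWidth (L : ℂ →L[ℝ] X) (ε s : ℝ) : ℝ :=
  sSup {w ∈ Set.Icc 0 Real.pi | chordLength L s w ≤ ε}

theorem continuous_chordLength (hL : Function.Injective L) (s : ℝ) :
    Continuous (chordLength L s) := by
  have := continuous_circPt hL
  unfold chordLength
  fun_prop

theorem chordLength_zero (s : ℝ) : chordLength L s 0 = 0 := by
  simp [chordLength]

theorem chordLength_pi (hL : Function.Injective L) (s : ℝ) : chordLength L s Real.pi = 2 := by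
  have := norm_map_circPt_sub_add_pi hL ((s - Real.pi) / 2)
  rwa [show (s - Real.pi) / 2 + Real.pi = (s + Real.pi) / 2 by ring] at this

theorem bddAbove_chordWidth_set (ε s : ℝ) :
    BddAbove {w ∈ Set.Icc 0 Real.pi | chordLength L s w ≤ ε} :=
  ⟨Real.pi, fun _ h => h.1.2⟩

theorem chordWidth_mem (hL : Function.Injective L) {ε : ℝ} (hε : 0 ≤ ε) (s : ℝ) :
    chordWidth L ε s ∈ {w ∈ Set.Icc 0 Real.pi | chordLength L s w ≤ ε} := by
  refine IsClosed.csSup_mem ?_ ⟨0, ⟨le_rfl, Real.pi_pos.le⟩, ?_⟩ (bddAbove_chordWidth_set ε s)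
  · exact isClosed_Icc.inter (isClosed_Iic.preimage (continuous_chordLength hL s))
  · rwa [chordLength_zero]

theorem le_chordWidth {ε s w : ℝ} (h0 : 0 ≤ w) (hp : w ≤ Real.pi) (h : chordLength L s w ≤ ε) :
    w ≤ chordWidth L ε s :=
  le_csSup (bddAbove_chordWidth_set ε s) ⟨⟨h0, hp⟩, h⟩

theorem chordLength_chordWidth (hL : Function.Injective L) {ε : ℝ} (h0 : 0 ≤ ε) (h2 : ε ≤ 2)
    (s : ℝ) : chordLength L s (chordWidth L ε s) = ε := by
  obtain ⟨⟨hw0, hwp⟩, hw⟩ := chordWidth_mem hL h0 s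
  refine le_antisymm hw ?_
  obtain ⟨v, ⟨hv0, hvp⟩, hv⟩ := intermediate_value_Icc Real.pi_pos.le
    (continuous_chordLength hL s).continuousOn
    (show ε ∈ Set.Icc (chordLength L s 0) (chordLength L s Real.pi) by
      rw [chordLength_zero, chordLength_pi hL]; exact ⟨h0, h2⟩)
  have hvw := le_chordWidth hv0 hvp hv.le
  conv_lhs => rw [← hv]
  exact norm_map_circPt_sub_mono hL (by linarith) (by linarith) (by linarith) (by linarith)

theorem chordWidth_pos (hL : Function.Injective L) {ε : ℝ} (h0 : 0 < ε) (h2 : ε ≤ 2) (s : ℝ) :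
    0 < chordWidth L ε s := by
  refine lt_of_le_of_ne (chordWidth_mem hL h0.le s).1.1 fun h => ?_
  have := chordLength_chordWidth hL h0.le h2 s
  rw [← h, chordLength_zero] at this
  exact h0.ne this

theorem chordWidth_lt_pi (hL : Function.Injective L) {ε : ℝ} (h0 : 0 ≤ ε) (h2 : ε < 2) (s : ℝ) :
    chordWidth L ε s < Real.pi := by
  refine lt_of_le_of_ne (chordWidth_mem hL h0 s).1.2 fun h => ?_
  have := chordLength_chordWidth hL h0 h2.le s
  rw [h, chordLength_pi hL] at this
  exact h2.ne' this

/-- An arc of width w centred at t/2 contains the one of width w - (t - s) centred at s/2, whose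
chord is no longer; the roles can be exchanged. Consequently both endpoint angles are nondecreasing
and 1-Lipschitz in the parameter. -/
theorem abs_chordWidth_sub_le (hL : Function.Injective L) {ε : ℝ} (h0 : 0 ≤ ε) {s t : ℝ}
    (hst : s ≤ t) : |chordWidth L ε t - chordWidth L ε s| ≤ t - s := by
  obtain ⟨⟨hs0, hsp⟩, hs⟩ := chordWidth_mem hL h0 s
  obtain ⟨⟨ht0, htp⟩, ht⟩ := chordWidth_mem hL h0 t
  rw [abs_sub_le_iff]
  constructor
  · by_contra! h
    have := le_chordWidth (L := L) (ε := ε) (s := s) (w := chordWidth L ε t - (t - s))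
      (by linarith) (by linarith) ((norm_map_circPt_sub_mono hL (by linarith) (by linarith)
        (by linarith) (by linarith)).trans ht)
    linarith
  · by_contra! h
    have := le_chordWidth (L := L) (ε := ε) (s := t) (w := chordWidth L ε s - (t - s))
      (by linarith) (by linarith) ((norm_map_circPt_sub_mono hL (by linarith) (by linarith)
        (by linarith) (by linarith)).trans hs)
    linarith

theorem continuous_chordWidth (hL : Function.Injective L) {ε : ℝ} (h0 : 0 ≤ ε) :
    Continuous (chordWidth L ε) := by
  refine (LipschitzWith.of_le_add_mul 1 fun s t => ?_).continuous
  rw [NNReal.coe_one, one_mul, Real.dist_eq]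
  rcases le_total s t with h | h
  · have := (abs_sub_le_iff.1 (abs_chordWidth_sub_le hL h0 h)).2
    have := neg_abs_le (s - t)
    linarith
  · have := (abs_sub_le_iff.1 (abs_chordWidth_sub_le hL h0 h)).1
    have := le_abs_self (s - t)
    linarith

theorem chordWidth_add_two_pi (ε s : ℝ) :
    chordWidth L ε (s + 2 * Real.pi) = chordWidth L ε s := by
  have (w : ℝ) : chordLength L (s + 2 * Real.pi) w = chordLength L s w := by
    unfold chordLength
    rw [show (s + 2 * Real.pi - w) / 2 = (s - w) / 2 + Real.pi by ring,
      show (s + 2 * Real.pi + w) / 2 = (s + w) / 2 + Real.pi by ring, circPt_add_pi,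
      circPt_add_pi, neg_sub_neg, ← neg_sub, map_neg, norm_neg]
  simp only [chordWidth, this]

/-! ### The moving chord and its direction -/

/-- The angle of the first endpoint of the chord of length `ε` centred at `s / 2`. -/
noncomputable def startAngle (L : ℂ →L[ℝ] X) (ε s : ℝ) : ℝ := (s - chordWidth L ε s) / 2

/-- The angle of the second endpoint of the chord of length `ε` centred at `s / 2`. -/
noncomputable def endAngle (L : ℂ →L[ℝ] X) (ε s : ℝ) : ℝ := (s + chordWidth L ε s) / 2

/-- The chord of length `ε` centred at `s / 2`, as a vector. -/
noncomputable def chordVec (L : ℂ →L[ℝ] X) (ε s : ℝ) : ℂ :=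
  circPt L (startAngle L ε s) - circPt L (endAngle L ε s)

/-- A continuous choice of the angle of `-chordVec`. -/
noncomputable def chordAngle (L : ℂ →L[ℝ] X) (ε s : ℝ) : ℝ :=
  startAngle L ε s + Complex.arg (-chordVec L ε s * unitDir (-startAngle L ε s))

theorem unitDir_add (s t : ℝ) : unitDir (s + t) = unitDir s * unitDir t := by
  unfold unitDir
  rw [← Complex.exp_add]
  push_cast
  ring_nf

theorem unitDir_mul_neg (s : ℝ) : unitDir s * unitDir (-s) = 1 := by
  rw [← unitDir_add]
  simp [unitDir]

theorem norm_map_chordVec (hL : Function.Injective L) {ε : ℝ} (h0 : 0 ≤ ε) (h2 : ε ≤ 2)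
    (s : ℝ) : ‖L (chordVec L ε s)‖ = ε :=
  chordLength_chordWidth hL h0 h2 s

/-- This is why the chord vector sweeps area at ε² times the rate of the unit circle. -/
theorem neg_chordVec_eq (hL : Function.Injective L) {ε : ℝ} (h0 : 0 ≤ ε) (h2 : ε ≤ 2)
    (s : ℝ) : -chordVec L ε s = ε • circPt L (chordAngle L ε s) := by
  have h : -chordVec L ε s = (‖-chordVec L ε s * unitDir (-startAngle L ε s)‖ : ℝ) *
      unitDir (chordAngle L ε s) := by
    rw [chordAngle, unitDir_add, mul_left_comm]
    conv_rhs => rw [unitDir.eq_def (Complex.arg _), Complex.norm_mul_exp_arg_mul_I]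
    rw [mul_left_comm, unitDir_mul_neg, mul_one]
  have := circPt_of_polar hL (norm_nonneg _) h
  rwa [map_neg, norm_neg, norm_map_chordVec hL h0 h2] at this

theorem startAngle_add_two_pi (ε s : ℝ) :
    startAngle L ε (s + 2 * Real.pi) = startAngle L ε s + Real.pi := by
  rw [startAngle, chordWidth_add_two_pi, startAngle]; ring

theorem endAngle_add_two_pi (ε s : ℝ) :
    endAngle L ε (s + 2 * Real.pi) = endAngle L ε s + Real.pi := by
  rw [endAngle, chordWidth_add_two_pi, endAngle]; ring

theorem chordVec_add_two_pi (ε s : ℝ) :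
    chordVec L ε (s + 2 * Real.pi) = -chordVec L ε s := by
  rw [chordVec, startAngle_add_two_pi, endAngle_add_two_pi, circPt_add_pi, circPt_add_pi, chordVec]
  ring

/-- The vector whose argument is taken is unchanged, since both of its factors change sign; so the
advance is exactly π, with no stray multiple of 2π. -/
theorem chordAngle_add_two_pi (ε s : ℝ) :
    chordAngle L ε (s + 2 * Real.pi) = chordAngle L ε s + Real.pi := by
  have h : unitDir (-(startAngle L ε s + Real.pi)) = -unitDir (-startAngle L ε s) := by
    rw [← neg_eq_iff_eq_neg, ← unitDir_add_pi]; congr 1; ring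
  rw [chordAngle, startAngle_add_two_pi, chordVec_add_two_pi, h, chordAngle, neg_mul_neg,
    neg_mul, add_right_comm]

/-- Seen from the direction of its starting point, the chord points into the open upper half plane,
away from the branch cut of `Complex.arg`. This needs 0 < width < π, hence 0 < ε < 2. -/
theorem continuous_chordAngle (hL : Function.Injective L) {ε : ℝ} (h0 : 0 < ε) (h2 : ε < 2) :
    Continuous (chordAngle L ε) := by
  have hw := continuous_chordWidth hL h0.le
  have hc := continuous_circPt hL
  have hu := continuous_unitDir
  have ha : Continuous (startAngle L ε) := by unfold startAngle; fun_prop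
  have hb : Continuous (endAngle L ε) := by unfold endAngle; fun_prop
  have hv : Continuous (chordVec L ε) := by unfold chordVec; fun_prop
  refine ha.add (continuous_iff_continuousAt.2 fun s => ?_)
  have hf : Continuous fun s => -chordVec L ε s * unitDir (-startAngle L ε s) := by fun_prop
  refine (Complex.continuousAt_arg (Or.inr (ne_of_gt ?_))).comp hf.continuousAt
  have e : (-chordVec L ε s * unitDir (-startAngle L ε s)).im =
      circRadius L (endAngle L ε s) * Real.sin (chordWidth L ε s) := by
    have hw : chordWidth L ε s = endAngle L ε s - startAngle L ε s := by
      unfold endAngle startAngle; ring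
    simp only [chordVec, circPt, Complex.mul_im, Complex.neg_re, Complex.neg_im, Complex.sub_re,
      Complex.sub_im, Complex.smul_re, Complex.smul_im, unitDir_re, unitDir_im, smul_eq_mul,
      Real.sin_neg, Real.cos_neg]
    rw [hw, Real.sin_sub]
    ring
  rw [e]
  exact mul_pos (circRadius_pos hL _) (Real.sin_pos_of_pos_of_lt_pi (chordWidth_pos hL h0 h2.le s)
    (chordWidth_lt_pi hL h0.le h2 s))

end Level

/-! ### Finite-difference inequalities -/

/-- A function whose local decrease is at most quadratic does not decrease. -/
theorem le_of_forall_sub_ge_neg_sq {f : ℝ → ℝ} {T K δ : ℝ} (hT : 0 < T) (hδ : 0 < δ)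
    (h : ∀ s ∈ Set.Icc 0 T, ∀ t ∈ Set.Icc 0 T, s ≤ t → t - s < δ →
      -(K * (t - s) ^ 2) ≤ f t - f s) : f 0 ≤ f T := by
  -- Over n equal steps the total loss is at most n · K(T/n)² = KT²/n.
  have hlim : Filter.Tendsto (fun n : ℕ => -(K * T ^ 2 / n)) Filter.atTop (nhds 0) := by
    simpa using (tendsto_const_div_atTop_nhds_zero_nat (K * T ^ 2)).neg
  have hlim' := tendsto_const_div_atTop_nhds_zero_nat T
  have : 0 ≤ f T - f 0 := by
    refine le_of_tendsto hlim ?_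
    filter_upwards [hlim'.eventually_lt_const hδ, Filter.eventually_gt_atTop 0] with n hn hn0
    have hn' : (0 : ℝ) < n := by exact_mod_cast hn0
    have hsum := Finset.sum_range_sub (fun i : ℕ => f (i * (T / n))) n
    have e : (n : ℝ) * (T / n) = T := by field_simp
    simp only [e, Nat.cast_zero, zero_mul] at hsum
    rw [← hsum]
    have hle : ∑ i ∈ Finset.range n, -(K * (T / n) ^ 2) ≤
        ∑ i ∈ Finset.range n, (f ((i + 1 : ℕ) * (T / n)) - f (i * (T / n))) := by
      refine Finset.sum_le_sum fun i hi => ?_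
      have hi' : ((i + 1 : ℕ) : ℝ) ≤ n := by exact_mod_cast Finset.mem_range.1 hi
      have hd : 0 < T / n := by positivity
      have e1 : ((i + 1 : ℕ) : ℝ) * (T / n) - i * (T / n) = T / n := by push_cast; ring
      have hm : ((i + 1 : ℕ) : ℝ) * (T / n) ≤ T := by
        calc _ ≤ (n : ℝ) * (T / n) := by gcongr
          _ = T := e
      have h0 : 0 ≤ (i : ℝ) * (T / n) := by positivity
      have := h (i * (T / n)) ⟨h0, by linarith⟩ ((i + 1 : ℕ) * (T / n)) ⟨by linarith, hm⟩
        (by linarith) (by rw [e1]; exact hn)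
      rwa [e1] at this
    rw [Finset.sum_const, Finset.card_range, nsmul_eq_mul] at hle
    refine le_trans (le_of_eq ?_) hle
    field_simp
  linarith

section Main

variable {X : Type*} [NormedAddCommGroup X] [NormedSpace ℝ X] {L : ℂ →L[ℝ] X}

theorem exists_mem_normingFunctionals {x : X} (hx : ‖x‖ = 1) :
    ∃ p, p ∈ normingFunctionals X x :=
  exists_dual_vector ℝ x (by rw [hx]; exact one_ne_zero)

theorem abs_apply_le_of_norm_eq_one {p : X →L[ℝ] ℝ} (hp : ‖p‖ = 1) (x : X) : |p x| ≤ ‖x‖ := by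
  simpa [hp] using p.le_opNorm x

/-- Two nearby support lines bound the direction of the chord between their contact points. -/
theorem planeDet_chord_ge {x y u v : ℂ} {σ c κ : ℝ} (hσ : |σ| ≤ 1) (hx : ‖L x‖ = 1)
    (hy : ‖L y‖ = 1) (hxu : ∀ p ∈ normingFunctionals X (L x), c ≤ σ * p (L u))
    (hyv : ∀ p ∈ normingFunctionals X (L y), c ≤ σ * p (L v))
    (huv : ‖L (v - u)‖ ≤ κ) (hxy : ‖L (y - x)‖ ≤ κ) (hdet : 0 ≤ planeDet x y) :
    (2 * c - κ) * planeDet x y - κ * |planeDet (u + v) (y - x)| ≤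
      σ * planeDet (u + v) (y - x) := by
  obtain ⟨p, hp⟩ := exists_mem_normingFunctionals hx
  obtain ⟨q, hq⟩ := exists_mem_normingFunctionals hy
  have hpd : p (L (y - x)) ≤ 0 := by
    have := le_of_abs_le (abs_apply_le_of_norm_eq_one hp.1 (L y))
    rw [map_sub, map_sub, hp.2, hx]; linarith
  have hqd : 0 ≤ q (L (y - x)) := by
    have := le_of_abs_le (abs_apply_le_of_norm_eq_one hq.1 (L x))
    rw [map_sub, map_sub, hq.2, hy]; linarith
  -- As p(y - x) ≤ 0 ≤ q(y - x), some convex combination of p and q kills the chord direction y - x.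
  -- It stands in for the functional supporting the circle along a tangent.
  obtain ⟨l, hl0, hl1, hl⟩ : ∃ l : ℝ, 0 ≤ l ∧ l ≤ 1 ∧
      (1 - l) * p (L (y - x)) + l * q (L (y - x)) = 0 := by
    rcases (sub_nonneg.2 (hpd.trans hqd)).eq_or_lt with h | h
    · exact ⟨0, le_rfl, zero_le_one, by linarith⟩
    · refine ⟨-p (L (y - x)) / (q (L (y - x)) - p (L (y - x))), div_nonneg (by linarith) h.le,
        (div_le_one h).2 (by linarith), ?_⟩
      field_simp
      ring
  have hσp (r : X →L[ℝ] ℝ) (hr : ‖r‖ = 1) : |σ * r (L (v - u))| ≤ κ := by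
    rw [abs_mul]
    have := (abs_apply_le_of_norm_eq_one hr (L (v - u))).trans huv
    nlinarith [abs_nonneg (r (L (v - u))), abs_nonneg σ]
  set g : ℂ →ₗ[ℝ] ℝ := ((1 - l) • p.comp L + l • q.comp L : ℂ →L[ℝ] ℝ).toLinearMap with hg
  have hga (w : ℂ) : g w = (1 - l) * p (L w) + l * q (L w) := by
    simp [hg]
  have hpu : 2 * c - κ ≤ σ * p (L (u + v)) := by
    have h1 := hxu p hp
    have h2 := abs_le.1 (hσp p hp.1)
    have e : σ * p (L (u + v)) = 2 * (σ * p (L u)) + σ * p (L (v - u)) := by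
      simp only [map_add, map_sub]; ring
    linarith [h2.1]
  have hqu : 2 * c - κ ≤ σ * q (L (u + v)) := by
    have h1 := hyv q hq
    have h2 := abs_le.1 (hσp q hq.1)
    have e : σ * q (L (u + v)) = 2 * (σ * q (L v)) - σ * q (L (v - u)) := by
      simp only [map_add, map_sub]; ring
    linarith [h2.2]
  have hgu : 2 * c - κ ≤ σ * g (u + v) := by
    rw [hga]
    nlinarith [mul_le_mul_of_nonneg_left hpu (sub_nonneg.2 hl1),
      mul_le_mul_of_nonneg_left hqu hl0]
  have hgx : |1 - g x| ≤ κ := by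
    have e : 1 - g x = l * q (L (y - x)) := by
      rw [hga, map_sub, map_sub, hp.2, hq.2, hx, hy]; ring
    rw [e, abs_mul, abs_of_nonneg hl0]
    have := (abs_apply_le_of_norm_eq_one hq.1 (L (y - x))).trans hxy
    nlinarith [abs_nonneg (q (L (y - x)))]
  have key := planeDet_mul_apply g (u + v) x (y - x) (by rw [hga]; exact hl)
  have e : planeDet x (y - x) = planeDet x y := by
    simp only [planeDet, Complex.sub_re, Complex.sub_im]; ring
  rw [e] at key
  set E := planeDet (u + v) (y - x)
  have h1 : σ * E = σ * g (u + v) * planeDet x y + σ * ((1 - g x) * E) := by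
    linear_combination σ * key
  have h2 : |σ * ((1 - g x) * E)| ≤ κ * |E| := by
    rw [abs_mul, abs_mul]
    calc _ ≤ 1 * (|1 - g x| * |E|) := by gcongr
      _ ≤ _ := by rw [one_mul]; gcongr
  have h3 := mul_le_mul_of_nonneg_right hgu hdet
  linarith [(abs_le.1 h2).1]

/-- The product rule behind the area argument, for the difference of two curves. -/
theorem planeDet_add_sub_eq (x y u v : ℂ) : planeDet (u + v) (y - x) =
    planeDet x y - planeDet (x - u) (y - v) + planeDet u v - (planeDet y v - planeDet x u) := by
  simp only [planeDet, Complex.sub_re, Complex.sub_im, Complex.add_re, Complex.add_im]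
  ring

/-- Uniform continuity first confines the angle difference to where |θ| ≤ (π/2)|sin θ|. The sine is
then bounded by the determinant of two points of the circle, and so by their difference, a
chord-vector difference divided by ε. -/
theorem exists_chordAngle_lipschitz (hL : Function.Injective L) {ε : ℝ} (h0 : 0 < ε)
    (h2 : ε < 2) (T : ℝ) : ∃ K, 0 ≤ K ∧ ∃ δ > 0, ∀ s ∈ Set.Icc 0 T, ∀ t ∈ Set.Icc 0 T,
      |t - s| < δ → |chordAngle L ε t - chordAngle L ε s| ≤
        K * ‖chordVec L ε t - chordVec L ε s‖ := by
  obtain ⟨K, hK1, -, -, hKr, -, hKx, -⟩ := exists_circ_constants hL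
  have huc := isCompact_Icc.uniformContinuousOn_of_continuous
    (s := Set.Icc 0 T) (continuous_chordAngle hL h0 h2).continuousOn
  obtain ⟨δ, hδ, hδ'⟩ := Metric.uniformContinuousOn_iff.1 huc 1 one_pos
  refine ⟨Real.pi * K ^ 3 / ε, by positivity, δ, hδ, fun s hs t ht hst => ?_⟩
  set a := chordAngle L ε s with ha
  set b := chordAngle L ε t with hb
  have hab : |b - a| ≤ Real.pi / 2 := by
    have := hδ' t ht s hs hst
    rw [Real.dist_eq] at this
    linarith [Real.pi_gt_three]
  have h1 := Real.mul_abs_le_abs_sin hab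
  have hra := circRadius_pos hL a
  have hrb := circRadius_pos hL b
  have h3 : |Real.sin (b - a)| ≤ K ^ 2 * |planeDet (circPt L a) (circPt L b)| := by
    rw [planeDet_circPt, abs_mul, abs_of_pos (mul_pos hra hrb), ← mul_assoc]
    have : 1 ≤ K ^ 2 * (circRadius L a * circRadius L b) := by
      have := one_le_mul_of_one_le_of_one_le (hKr a) (hKr b)
      linarith
    exact le_mul_of_one_le_left (abs_nonneg _) this
  have h4 : planeDet (circPt L a) (circPt L b) =
      planeDet (circPt L a) (circPt L b - circPt L a) := by
    simp only [planeDet, Complex.sub_re, Complex.sub_im]; ring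
  have h5 : circPt L b - circPt L a = ε⁻¹ • (chordVec L ε s - chordVec L ε t) := by
    have e1 := neg_chordVec_eq hL h0.le h2.le s
    have e2 := neg_chordVec_eq hL h0.le h2.le t
    rw [show chordVec L ε s - chordVec L ε t = -chordVec L ε t - -chordVec L ε s by ring, e1, e2,
      ← smul_sub, smul_smul, inv_mul_cancel₀ h0.ne', one_smul]
  have h6 : |planeDet (circPt L a) (circPt L b)| ≤
      2 * (K * (ε⁻¹ * ‖chordVec L ε t - chordVec L ε s‖)) := by
    rw [h4]
    refine (abs_planeDet_le _ _).trans ?_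
    rw [h5, norm_smul, Real.norm_of_nonneg (by positivity), norm_sub_rev]
    gcongr
    exact hKx a
  have hpi := Real.pi_pos
  have h7 : |b - a| ≤ Real.pi / 2 * |Real.sin (b - a)| := by
    rw [div_mul_eq_mul_div, div_le_iff₀ hpi] at h1
    linarith
  calc |b - a| ≤ Real.pi / 2 * |Real.sin (b - a)| := h7
    _ ≤ Real.pi / 2 * (K ^ 2 * (2 * (K * (ε⁻¹ * ‖chordVec L ε t - chordVec L ε s‖)))) := by
        gcongr
        exact h3.trans (by gcongr)
    _ = _ := by field_simp

end Main

/-! ### The mean-value argument -/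

section Final

variable {X : Type*} [NormedAddCommGroup X] [NormedSpace ℝ X]

theorem circPt_sub_chordVec (L : ℂ →L[ℝ] X) (ε s : ℝ) :
    circPt L (startAngle L ε s) - chordVec L ε s = circPt L (endAngle L ε s) := by
  rw [chordVec, sub_sub_cancel]

theorem planeDet_chordVec {L : ℂ →L[ℝ] X} (hL : Function.Injective L) {ε : ℝ} (h0 : 0 ≤ ε)
    (h2 : ε ≤ 2) (s t : ℝ) : planeDet (chordVec L ε s) (chordVec L ε t) =
      ε ^ 2 * planeDet (circPt L (chordAngle L ε s)) (circPt L (chordAngle L ε t)) := by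
  have e1 := neg_chordVec_eq hL h0 h2 s
  have e2 := neg_chordVec_eq hL h0 h2 t
  rw [← neg_neg (chordVec L ε s), ← neg_neg (chordVec L ε t), e1, e2]
  simp only [planeDet, Complex.neg_re, Complex.neg_im, Complex.smul_re, Complex.smul_im,
    smul_eq_mul]
  ring

/-- The area functional along the curve of chords of length `ε`, corrected by `2 * c` times the
area swept by the starting point. -/
noncomputable def chordPotential (L : ℂ →L[ℝ] X) (ε σ c s : ℝ) : ℝ :=
  σ * (circArea L (startAngle L ε s) - circArea L (endAngle L ε s) +
    ε ^ 2 * circArea L (chordAngle L ε s) -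
    planeDet (circPt L (startAngle L ε s)) (chordVec L ε s)) -
  2 * c * circArea L (startAngle L ε s)

/-- All three angles advance by π: the endpoint areas cancel, the chord direction contributes ε²,
and the determinant returns to its value because both its vectors change sign. -/
theorem chordPotential_two_pi_sub {L : ℂ →L[ℝ] X} (hL : Function.Injective L) (ε σ c : ℝ) :
    chordPotential L ε σ c (2 * Real.pi) - chordPotential L ε σ c 0 =
      (σ * ε ^ 2 - 2 * c) * circArea L Real.pi := by
  have ha := startAngle_add_two_pi (L := L) ε 0
  have hb := endAngle_add_two_pi (L := L) ε 0
  have hw := chordAngle_add_two_pi (L := L) ε 0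
  have hu := chordVec_add_two_pi (L := L) ε 0
  rw [zero_add] at ha hb hw hu
  have e1 := circArea_add_pi hL (startAngle L ε 0)
  have e2 := circArea_add_pi hL (endAngle L ε 0)
  have e3 := circArea_add_pi hL (chordAngle L ε 0)
  have e4 : planeDet (circPt L (startAngle L ε 0 + Real.pi)) (-chordVec L ε 0) =
      planeDet (circPt L (startAngle L ε 0)) (chordVec L ε 0) := by
    rw [circPt_add_pi]
    simp only [planeDet, Complex.neg_re, Complex.neg_im]
    ring
  unfold chordPotential
  rw [ha, hb, hw, hu, e4]
  linear_combination (σ - 2 * c) * e1 - σ * e2 + σ * ε ^ 2 * e3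

theorem neg_le_mul_of_abs_le {r a b : ℝ} (hr : |r| ≤ 1) (hab : |a| ≤ b) : -b ≤ r * a := by
  have h : |r * a| ≤ b := by
    rw [abs_mul]
    exact (mul_le_of_le_one_left (abs_nonneg a) hr).trans hab
  exact (abs_le.1 h).1

/-- The bound on the gaps makes the potential nondecreasing up to quadratic errors, so its increment
over half a turn, (σε² - 2c) times a positive area, is nonnegative. -/
theorem le_of_forall_supportGaps_of_injective {L : ℂ →L[ℝ] X} (hL : Function.Injective L)
    {ε σ c : ℝ} (h0 : 0 < ε) (h2 : ε < 2) (hσ : |σ| ≤ 1)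
    (h : ∀ s ∈ supportGaps X {ε}, c ≤ σ * s) : c ≤ σ * (ε ^ 2 / 2) := by
  obtain ⟨K, hK1, hKL, hKr, -, -, hKx, hKd⟩ := exists_circ_constants hL
  obtain ⟨A, hA0, hA⟩ := exists_circArea_sub_planeDet_le hL
  obtain ⟨W, hW0, δ, hδ, hW⟩ := exists_chordAngle_lipschitz hL h0 h2 (2 * Real.pi)
  have hK0 : 0 ≤ K := by linarith
  have hgap (s : ℝ) : ∀ p ∈ normingFunctionals X (L (circPt L (startAngle L ε s))),
      c ≤ σ * p (L (chordVec L ε s)) := fun p hp =>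
    h _ ⟨L (circPt L (startAngle L ε s)), L (circPt L (endAngle L ε s)), p, norm_map_circPt hL _,
      norm_map_circPt hL _, by
        rw [← map_sub]; exact norm_map_chordVec hL h0.le h2.le s, hp, by
        rw [← map_sub]; rfl⟩
  have hmono := le_of_forall_sub_ge_neg_sq (f := chordPotential L ε σ c) (T := 2 * Real.pi)
    -- The last entry keeps the change of chord angle below 1. In the next line, 18 = 2 + 16 comes
    -- from the two κ-terms of `planeDet_chord_ge`, and the factor of `A` collects the errors of the
    -- two endpoint areas, the chord-direction area and the 2c-term.
    (δ := min (min δ 1) (1 / (2 * W * K + 1)))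
    (K := 18 * K ^ 4 + A * (2 + ε ^ 2 * (2 * W * K) ^ 2 + 2 * |c|)) Real.two_pi_pos
    (by positivity) fun s hs t ht hst hlt => ?_
  · have := chordPotential_two_pi_sub hL ε σ c
    have hpos := circArea_pi_pos hL
    have h3 : 0 ≤ (σ * ε ^ 2 - 2 * c) * circArea L Real.pi := by linarith
    have := nonneg_of_mul_nonneg_left h3 hpos
    linarith
  · rw [lt_min_iff, lt_min_iff] at hlt
    obtain ⟨⟨hlt1, hlt2⟩, hlt3⟩ := hlt
    have hd0 : 0 ≤ t - s := by linarith
    have hwid := abs_sub_le_iff.1 (abs_chordWidth_sub_le hL h0.le hst)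
    have ha0 : 0 ≤ startAngle L ε t - startAngle L ε s := by unfold startAngle; linarith
    have ha1 : startAngle L ε t - startAngle L ε s ≤ t - s := by unfold startAngle; linarith
    have hb0 : 0 ≤ endAngle L ε t - endAngle L ε s := by unfold endAngle; linarith
    have hb1 : endAngle L ε t - endAngle L ε s ≤ t - s := by unfold endAngle; linarith
    have hw := hW s hs t ht (by rwa [abs_of_nonneg hd0])
    have hAa := hA (startAngle L ε s) (startAngle L ε t) (by rw [abs_of_nonneg ha0]; linarith)
    have hAb := hA (endAngle L ε s) (endAngle L ε t) (by rw [abs_of_nonneg hb0]; linarith)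
    have hxy : ‖circPt L (startAngle L ε t) - circPt L (startAngle L ε s)‖ ≤ K * (t - s) := by
      refine (hKd _ _).trans ?_
      rw [abs_of_nonneg ha0]; gcongr
    have huv : ‖chordVec L ε t - chordVec L ε s‖ ≤ 2 * K * (t - s) := by
      have e : chordVec L ε t - chordVec L ε s =
          (circPt L (startAngle L ε t) - circPt L (startAngle L ε s)) -
          (circPt L (endAngle L ε t) - circPt L (endAngle L ε s)) := by
        unfold chordVec; ring
      have hb2 : ‖circPt L (endAngle L ε t) - circPt L (endAngle L ε s)‖ ≤ K * (t - s) := by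
        refine (hKd _ _).trans ?_
        rw [abs_of_nonneg hb0]; gcongr
      rw [e]
      refine (norm_sub_le _ _).trans ?_
      linarith
    have hw' : |chordAngle L ε t - chordAngle L ε s| ≤ 2 * W * K * (t - s) := by
      refine hw.trans ((mul_le_mul_of_nonneg_left huv hW0).trans (le_of_eq ?_))
      ring
    have hWK : 0 ≤ 2 * W * K := by positivity
    have hw1 : |chordAngle L ε t - chordAngle L ε s| ≤ 1 := by
      rw [lt_div_iff₀ (by linarith)] at hlt3
      linarith
    have hAw := hA (chordAngle L ε s) (chordAngle L ε t) hw1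
    have hdet : planeDet (circPt L (startAngle L ε s)) (circPt L (startAngle L ε t)) =
        _ := planeDet_circPt _ _
    have hra := circRadius_pos hL (startAngle L ε s)
    have hrb := circRadius_pos hL (startAngle L ε t)
    have hdet0 : 0 ≤ planeDet (circPt L (startAngle L ε s)) (circPt L (startAngle L ε t)) := by
      rw [hdet]
      have := Real.sin_nonneg_of_nonneg_of_le_pi ha0 (by linarith [Real.pi_gt_three])
      positivity
    have hdet1 : planeDet (circPt L (startAngle L ε s)) (circPt L (startAngle L ε t)) ≤
        K ^ 2 * (t - s) := by
      rw [hdet, sq]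
      have := Real.sin_le ha0
      have h5 := mul_le_mul (hKr (startAngle L ε s)) (hKr (startAngle L ε t)) hrb.le hK0
      calc _ ≤ circRadius L (startAngle L ε s) * circRadius L (startAngle L ε t) * (t - s) := by
            gcongr; linarith
        _ ≤ _ := by gcongr
    have hsum (s : ℝ) : ‖chordVec L ε s‖ ≤ 2 * K := by
      refine (norm_sub_le _ _).trans ?_
      linarith [hKx (startAngle L ε s), hKx (endAngle L ε s)]
    have hE : |planeDet (chordVec L ε s + chordVec L ε t)
        (circPt L (startAngle L ε t) - circPt L (startAngle L ε s))| ≤ 8 * K ^ 2 * (t - s) := by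
      refine (abs_planeDet_le _ _).trans ?_
      have h5 : ‖chordVec L ε s + chordVec L ε t‖ ≤ 4 * K :=
        (norm_add_le _ _).trans (by linarith [hsum s, hsum t])
      have h6 := mul_le_mul h5 hxy (norm_nonneg _) (by linarith)
      linarith
    have hmain := planeDet_chord_ge hσ (norm_map_circPt hL _) (norm_map_circPt hL _) (hgap s)
      (hgap t) (κ := 2 * K ^ 2 * (t - s))
      ((hKL _).trans ((mul_le_mul_of_nonneg_left huv hK0).trans (le_of_eq (by ring))))
      ((hKL _).trans ((mul_le_mul_of_nonneg_left hxy hK0).trans (by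
        have : 0 ≤ K ^ 2 * (t - s) := by positivity
        linarith)))
      hdet0
    have hκ : 0 ≤ 2 * K ^ 2 * (t - s) := by positivity
    have hκ1 := mul_le_mul_of_nonneg_left hdet1 hκ
    have hκ2 := mul_le_mul_of_nonneg_left hE hκ
    have hprod := planeDet_add_sub_eq (circPt L (startAngle L ε s)) (circPt L (startAngle L ε t))
      (chordVec L ε s) (chordVec L ε t)
    rw [circPt_sub_chordVec, circPt_sub_chordVec, planeDet_chordVec hL h0.le h2.le] at hprod
    generalize planeDet (chordVec L ε s + chordVec L ε t)
        (circPt L (startAngle L ε t) - circPt L (startAngle L ε s)) = E at *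
    have hsqa : (startAngle L ε t - startAngle L ε s) ^ 2 ≤ (t - s) ^ 2 := by gcongr
    have hsqb : (endAngle L ε t - endAngle L ε s) ^ 2 ≤ (t - s) ^ 2 := by gcongr
    have hsqw : (chordAngle L ε t - chordAngle L ε s) ^ 2 ≤ (2 * W * K * (t - s)) ^ 2 := by
      rw [← sq_abs]; gcongr
    replace hAa := hAa.trans (mul_le_mul_of_nonneg_left hsqa hA0)
    replace hAb := hAb.trans (mul_le_mul_of_nonneg_left hsqb hA0)
    replace hAw := hAw.trans (mul_le_mul_of_nonneg_left hsqw hA0)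
    have i1 := neg_le_mul_of_abs_le hσ hAa
    have i2 := neg_le_mul_of_abs_le (by rwa [abs_neg] : |-σ| ≤ 1) hAb
    have i3 := mul_le_mul_of_nonneg_left (neg_le_mul_of_abs_le hσ hAw) (sq_nonneg ε)
    have i4 : -(|c| * (A * (t - s) ^ 2)) ≤ -c * (circArea L (startAngle L ε t) -
        circArea L (startAngle L ε s) -
        planeDet (circPt L (startAngle L ε s)) (circPt L (startAngle L ε t))) := by
      have := mul_le_mul_of_nonneg_left hAa (abs_nonneg c)
      rw [← abs_neg c, ← abs_mul, abs_neg] at this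
      exact (abs_le.1 this).1
    have hEq := congrArg (fun r => σ * r) hprod
    unfold chordPotential
    linarith only [hmain, hκ1, hκ2, hEq, i1, i2, i3, i4]

theorem exists_injective_complex (hX : 2 ≤ Module.rank ℝ X) :
    ∃ L : ℂ →L[ℝ] X, Function.Injective L := by
  obtain ⟨f, hf⟩ := Module.le_rank_iff_exists_linearMap.1
    (show ((2 : ℕ) : Cardinal) ≤ Module.rank ℝ X by exact_mod_cast hX)
  refine ⟨LinearMap.toContinuousLinearMap (f ∘ₗ Complex.basisOneI.equivFun.toLinearMap), ?_⟩
  exact hf.comp Complex.basisOneI.equivFun.injective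

/-- Guards against the default value 0 of `sInf` and `sSup` on the empty set. -/
theorem supportGaps_singleton_nonempty (hX : 2 ≤ Module.rank ℝ X) {ε : ℝ}
    (hε : ε ∈ Set.Icc (0 : ℝ) 2) : (supportGaps X {ε}).Nonempty := by
  obtain ⟨L, hL⟩ := exists_injective_complex hX
  obtain ⟨p, hp⟩ := exists_mem_normingFunctionals (norm_map_circPt hL (startAngle L ε 0))
  refine ⟨_, L (circPt L (startAngle L ε 0)), L (circPt L (endAngle L ε 0)), p,
    norm_map_circPt hL _, norm_map_circPt hL _, ?_, hp, rfl⟩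
  rw [← map_sub]
  exact norm_map_chordVec hL hε.1 hε.2 0

/-- Neither `s ↦ s` nor `s ↦ -s` is bounded below on the support gaps of the chords of length `ε`
by more than its value at `ε ^ 2 / 2`. -/
theorem le_of_forall_supportGaps (hX : 2 ≤ Module.rank ℝ X) {ε σ c : ℝ}
    (hε : ε ∈ Set.Icc (0 : ℝ) 2) (hσ : |σ| ≤ 1) (h : ∀ s ∈ supportGaps X {ε}, c ≤ σ * s) :
    c ≤ σ * (ε ^ 2 / 2) := by
  obtain ⟨L, hL⟩ := exists_injective_complex hX
  have hx := norm_map_circPt hL 0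
  obtain ⟨p, hp⟩ := exists_mem_normingFunctionals hx
  -- The extreme lengths lack a moving chord direction, but one pair decides each: equal points give
  -- gap 0, antipodal points give gap 2.
  rcases hε.1.eq_or_lt with rfl | h0
  · have := h _ ⟨_, _, p, hx, hx, by simp, hp, rfl⟩
    simpa using this
  rcases hε.2.eq_or_lt with rfl | h2
  · have e : L (circPt L 0) - -L (circPt L 0) = (2 : ℝ) • L (circPt L 0) := by
      rw [sub_neg_eq_add, two_smul]
    have := h _ ⟨_, -L (circPt L 0), p, hx, by rwa [norm_neg], by
      rw [e, norm_smul, hx]; simp, hp, rfl⟩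
    rw [e, map_smul, hp.2, hx] at this
    norm_num at this ⊢
    exact this
  · exact le_of_forall_supportGaps_of_injective hL h0 h2 hσ h

theorem supportGaps_mono {D D' : Set ℝ} (h : D ⊆ D') : supportGaps X D ⊆ supportGaps X D' := by
  rintro s ⟨x, z, p, hx, hz, hD, hp, rfl⟩
  exact ⟨x, z, p, hx, hz, h hD, hp, rfl⟩

/-- Chords of length exactly ε already suffice, so both forms of the constraint are covered by
asking only that ε be admissible. -/
theorem sInf_supportGaps_le (hX : 2 ≤ Module.rank ℝ X) {ε : ℝ} (hε : ε ∈ Set.Icc (0 : ℝ) 2)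
    {D : Set ℝ} (hD : ε ∈ D) : sInf (supportGaps X D) ≤ ε ^ 2 / 2 := by
  have hb : BddBelow (supportGaps X D) := bddBelow_Icc.mono (supportGaps_subset_Icc X D)
  have := le_of_forall_supportGaps hX hε (σ := 1) (by simp) fun s hs => by
    rw [one_mul]
    exact csInf_le hb (supportGaps_mono (Set.singleton_subset_iff.2 hD) hs)
  rwa [one_mul] at this

theorem le_sSup_supportGaps (hX : 2 ≤ Module.rank ℝ X) {ε : ℝ} (hε : ε ∈ Set.Icc (0 : ℝ) 2)
    {D : Set ℝ} (hD : ε ∈ D) : ε ^ 2 / 2 ≤ sSup (supportGaps X D) := by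
  have hb : BddAbove (supportGaps X D) := bddAbove_Icc.mono (supportGaps_subset_Icc X D)
  have := le_of_forall_supportGaps hX hε (σ := -1) (c := -sSup (supportGaps X D)) (by simp)
    fun s hs => by
      rw [neg_one_mul]
      exact neg_le_neg (le_csSup hb (supportGaps_mono (Set.singleton_subset_iff.2 hD) hs))
  linarith

end Final

/-! ### Hilbert spaces -/

section Hilbert

variable {H : Type*} [NormedAddCommGroup H] [InnerProductSpace ℝ H] [CompleteSpace H]

/-- By Riesz representation and equality in Cauchy–Schwarz, p is the inner product with x, so the
gap is 1 - ⟨x, z⟩. -/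
theorem apply_sub_eq_of_mem_normingFunctionals {x z : H} {p : H →L[ℝ] ℝ} (hx : ‖x‖ = 1)
    (hz : ‖z‖ = 1) (hp : p ∈ normingFunctionals H x) : p (x - z) = ‖x - z‖ ^ 2 / 2 := by
  obtain ⟨y, rfl⟩ := (InnerProductSpace.toDual ℝ H).surjective p
  obtain ⟨hp1, hp2⟩ := hp
  rw [LinearIsometryEquiv.norm_map] at hp1
  rw [InnerProductSpace.toDual_apply_apply, hx, inner_eq_one_iff_of_norm_eq_one hp1 hx] at hp2
  rw [hp2, InnerProductSpace.toDual_apply_apply, inner_sub_right, real_inner_self_eq_norm_sq,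
    norm_sub_sq_real, hx, hz]
  ring

theorem exists_mem_eq_of_mem_supportGaps {D : Set ℝ} {s : ℝ} (hs : s ∈ supportGaps H D) :
    ∃ r ∈ D, 0 ≤ r ∧ s = r ^ 2 / 2 := by
  obtain ⟨x, z, p, hx, hz, hD, hp, rfl⟩ := hs
  exact ⟨_, hD, norm_nonneg _, apply_sub_eq_of_mem_normingFunctionals hx hz hp⟩

theorem sInf_supportGaps_eq (hH : 2 ≤ Module.rank ℝ H) {ε : ℝ} (hε : ε ∈ Set.Icc (0 : ℝ) 2)
    {D : Set ℝ} (hD : ε ∈ D) (hle : ∀ r ∈ D, ε ≤ r) : sInf (supportGaps H D) = ε ^ 2 / 2 := by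
  refine le_antisymm (sInf_supportGaps_le hH hε hD) (le_csInf ?_ fun s hs => ?_)
  · exact (supportGaps_singleton_nonempty hH hε).mono
      (supportGaps_mono (Set.singleton_subset_iff.2 hD))
  · obtain ⟨r, hr, -, rfl⟩ := exists_mem_eq_of_mem_supportGaps hs
    have := pow_le_pow_left₀ hε.1 (hle r hr) 2
    linarith

theorem sSup_supportGaps_eq (hH : 2 ≤ Module.rank ℝ H) {ε : ℝ} (hε : ε ∈ Set.Icc (0 : ℝ) 2)
    {D : Set ℝ} (hD : ε ∈ D) (hle : ∀ r ∈ D, r ≤ ε) : sSup (supportGaps H D) = ε ^ 2 / 2 := by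
  refine le_antisymm (csSup_le ?_ fun s hs => ?_) (le_sSup_supportGaps hH hε hD)
  · exact (supportGaps_singleton_nonempty hH hε).mono
      (supportGaps_mono (Set.singleton_subset_iff.2 hD))
  · obtain ⟨r, hr, hr0, rfl⟩ := exists_mem_eq_of_mem_supportGaps hs
    have := pow_le_pow_left₀ hr0 (hle r hr) 2
    linarith

end Hilbert

theorem mainTheorem1
    (X : Type*) [NormedAddCommGroup X] [NormedSpace ℝ X] [CompleteSpace X]
    (hX : 2 ≤ Module.rank ℝ X)
    (H : Type*) [NormedAddCommGroup H] [InnerProductSpace ℝ H] [CompleteSpace H]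
    (hH : 2 ≤ Module.rank ℝ H)
    (ε : ℝ) (hε : ε ∈ Set.Icc (0 : ℝ) 2) :
    (phiMinus X ε ≤ phiMinus H ε ∧ phiMinus H ε = ε ^ 2 / 2 ∧
      ε ^ 2 / 2 = phiPlus H ε ∧ phiPlus H ε ≤ phiPlus X ε) ∧
    (phiMinusEq X ε ≤ phiMinusEq H ε ∧ phiMinusEq H ε = ε ^ 2 / 2 ∧
      ε ^ 2 / 2 = phiPlusEq H ε ∧ phiPlusEq H ε ≤ phiPlusEq X ε) := by
  have h1 : phiMinus H ε = ε ^ 2 / 2 :=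
    sInf_supportGaps_eq hH hε Set.self_mem_Ici fun _ hr => hr
  have h2 : phiPlus H ε = ε ^ 2 / 2 :=
    sSup_supportGaps_eq hH hε Set.self_mem_Iic fun _ hr => hr
  have h3 : phiMinusEq H ε = ε ^ 2 / 2 :=
    sInf_supportGaps_eq hH hε (Set.mem_singleton ε) fun _ hr => (Set.mem_singleton_iff.1 hr).ge
  have h4 : phiPlusEq H ε = ε ^ 2 / 2 :=
    sSup_supportGaps_eq hH hε (Set.mem_singleton ε) fun _ hr => (Set.mem_singleton_iff.1 hr).le
  rw [h1, h2, h3, h4]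
  exact ⟨⟨sInf_supportGaps_le hX hε Set.self_mem_Ici, rfl, rfl,
      le_sSup_supportGaps hX hε Set.self_mem_Iic⟩,
    ⟨sInf_supportGaps_le hX hε (Set.mem_singleton ε), rfl, rfl,
      le_sSup_supportGaps hX hε (Set.mem_singleton ε)⟩⟩
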